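/- Let $p$ be a prime and let $R$ be a (noetherian) regular commutative ring of characteristic $p$ which is $F$-finite, i.e. the Frobenius $F\colon R\to R$, $r\mapsto r^p$, is a finite ring map. Let $e\ge 0$. Write $F^e_*R$ for $R$ viewed as an $R$-module through $F^e$, so that $r\cdot x=r^{p^e}x$, put $D^{(e)}_R=\operatorname{End}_R(F^e_*R)$, and regard $F^e_*R$ as a left $D^{(e)}_R$-module by evaluation and $\operatorname{Hom}_R(F^e_*R,R)$ as an $R$-$D^{(e)}_R$-bimodule by post- and pre-composition. Then $F^e_*R$ is a locally free $R$-module of finite rank, and the Frobenius pullback $$F^{e*}=F^e_*R\otimes_R(-)\colon\ R\text{-mod}\longrightarrow D^{(e)}_R\text{-mod},$$ where $\delta\in D^{(e)}_R$ acts on $F^e_*R\otimes_R M$ as $\delta\otimes\mathrm{id}_M$, is an $R$-linear equivalence of categories (a Morita equivalence), with inverse functor $$T^e=\operatorname{Hom}_R(F^e_*R,R)\otimes_{D^{(e)}_R}(-)\colon\ D^{(e)}_R\text{-mod}\longrightarrow R\text{-mod}.$$ -/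

import Mathlib

open CategoryTheory
open scoped TensorProduct ModuleCat.Algebra

universe v u

noncomputable section

/-- `F^e_* R`: the ring `R`, regarded as an `R`-algebra (in particular as an `R`-module) through
the `e`-th iterate of the Frobenius, i.e. `r • x = r ^ (p ^ e) * x`. -/
def FrobeniusPushforward (R : Type u) (_p _e : ℕ) : Type u := R

namespace FrobeniusPushforward

variable (R : Type u) [CommRing R] (p e : ℕ)

instance : CommRing (FrobeniusPushforward R p e) := inferInstanceAs (CommRing R)

/-- The identity `R → F^e_* R`, as a map of rings (it is not `R`-linear). -/
def of : R ≃+* FrobeniusPushforward R p e := RingEquiv.refl R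

instance [ExpChar R p] : Algebra R (FrobeniusPushforward R p e) :=
  ((of R p e).toRingHom.comp (iterateFrobenius R p e)).toAlgebra

lemma smul_of [ExpChar R p] (r x : R) : r • of R p e x = of R p e (r ^ p ^ e * x) := rfl

end FrobeniusPushforward

variable (R : Type u) [CommRing R] (p e : ℕ) [ExpChar R p]

/-- `D^{(e)}_R = End_R (F^e_* R)`; the product is the composition of endomorphisms. -/
abbrev FrobeniusDiffOp : Type u := Module.End R (FrobeniusPushforward R p e)

/-- `Hom_R (F^e_* R, R)`. Its left `R`-module structure is by post-composition. -/
abbrev FrobeniusDual : Type u := FrobeniusPushforward R p e →ₗ[R] R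

/-- The Frobenius pullback `F^{e*} = F^e_* R ⊗_R –`, from `R`-modules to `D^{(e)}_R`-modules:
an operator `δ` acts on `F^e_* R ⊗_R M` as `δ ⊗ id`. -/
def frobeniusPullback :
    ModuleCat.{max u v} R ⥤ ModuleCat.{max u v} (FrobeniusDiffOp R p e) where
  obj M := ModuleCat.of (FrobeniusDiffOp R p e) (FrobeniusPushforward R p e ⊗[R] M)
  map f := ModuleCat.ofHom (TensorProduct.AlgebraTensorModule.map
    (LinearMap.id : FrobeniusPushforward R p e →ₗ[FrobeniusDiffOp R p e] _) f.hom)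
  map_id M := by
    ext
    rfl
  map_comp f g := by
    ext
    rfl

/-- For a left `D^{(e)}_R`-module `N`, the `R`-submodule of `Hom_R (F^e_* R, R) ⊗_ℤ N` generated by
the elements `φ · δ ⊗ n - φ ⊗ δ n`, where the right action `φ · δ` is pre-composition. -/
def frobeniusBalancing (N : Type*) [AddCommGroup N] [Module (FrobeniusDiffOp R p e) N] :
    Submodule R (FrobeniusDual R p e ⊗[ℤ] N) :=
  Submodule.span R {t | ∃ (φ : FrobeniusDual R p e) (δ : FrobeniusDiffOp R p e) (n : N),
    t = (φ ∘ₗ δ) ⊗ₜ[ℤ] n - φ ⊗ₜ[ℤ] (δ • n)}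

/-- The tensor product `Hom_R (F^e_* R, R) ⊗_{D^{(e)}_R} N` over the noncommutative ring
`D^{(e)}_R`, with the `R`-module structure coming from `Hom_R (F^e_* R, R)`. -/
abbrev FrobeniusDescentObj (N : Type*) [AddCommGroup N] [Module (FrobeniusDiffOp R p e) N] :=
  (FrobeniusDual R p e ⊗[ℤ] N) ⧸ frobeniusBalancing R p e N

/-- The map `id ⊗ g` on `Hom_R (F^e_* R, R) ⊗_{D^{(e)}_R} –`. -/
def frobeniusDescentMap {N N' : Type*} [AddCommGroup N] [Module (FrobeniusDiffOp R p e) N]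
    [AddCommGroup N'] [Module (FrobeniusDiffOp R p e) N'] (g : N →ₗ[FrobeniusDiffOp R p e] N') :
    FrobeniusDescentObj R p e N →ₗ[R] FrobeniusDescentObj R p e N' :=
  Submodule.mapQ _ _
    (TensorProduct.AlgebraTensorModule.map (LinearMap.id : FrobeniusDual R p e →ₗ[R] _)
      g.toAddMonoidHom.toIntLinearMap)
    (by
      rw [frobeniusBalancing, Submodule.span_le]
      rintro _ ⟨φ, δ, n, rfl⟩
      refine Submodule.subset_span ⟨φ, δ, g n, ?_⟩
      simp)

/-- The functor `T^e = Hom_R (F^e_* R, R) ⊗_{D^{(e)}_R} –` from `D^{(e)}_R`-modules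
to `R`-modules. -/
def frobeniusDescent :
    ModuleCat.{max u v} (FrobeniusDiffOp R p e) ⥤ ModuleCat.{max u v} R where
  obj N := ModuleCat.of R (FrobeniusDescentObj R p e N)
  map g := ModuleCat.ofHom (frobeniusDescentMap R p e g.hom)
  map_id N := by
    ext
    rfl
  map_comp f g := by
    ext
    rfl

end

/-- A module is locally free of finite rank if `Spec R` is covered by basic open sets `D(f)` over
which it is free of finite rank. -/
def IsLocallyFreeOfFiniteRank (R M : Type*) [CommRing R] [AddCommGroup M] [Module R M] : Prop :=
  ∀ P : PrimeSpectrum R, ∃ f ∉ P.asIdeal,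
    Module.Free (Localization.Away f) (LocalizedModule (Submonoid.powers f) M) ∧
    Module.Finite (Localization.Away f) (LocalizedModule (Submonoid.powers f) M)

/-!
By a theorem of Kunz, `F^e_* R` is flat. At a prime of `R` the localization is a regular local ring,
whose maximal ideal is generated by a regular sequence `x₁, …, x_d`. Acting on `F^e_* R` by these
elements amounts to acting on `R` by their `p ^ e`-th powers, which again form a regular sequence,
so the finitely generated module `F^e_* R` is free, one `x_i` being divided out at a time. Hence
`P = F^e_* R` is finite projective over `R`, and it is faithfully flat because the Frobenius is
bijective on `Spec R`.

For such a `P` the pairing `Hom_R(P, R) ⊗_R P → R` and the map `Hom_R(P, R) ⊗_R P → End_R(P)` to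
finite rank operators are both surjective. These two facts invert the evaluation
`Hom_R(P, R) ⊗_{End_R(P)} (P ⊗_R M) → M` and the action `P ⊗_R (Hom_R(P, R) ⊗_{End_R(P)} N) → N`.
-/

section RegularSequences

open IsLocalRing RingTheory.Sequence Pointwise

lemma isWeaklyRegular_of_subsingleton {R M : Type*} [CommRing R] [AddCommGroup M] [Module R M]
    [Subsingleton M] (rs : List R) : IsWeaklyRegular M rs := by
  induction rs generalizing M with
  | nil => exact .nil _ _
  | cons r rs ih => exact .cons (Function.injective_of_subsingleton _) ih

lemma isWeaklyRegular_of_exact {R A B C : Type*} [CommRing R] [AddCommGroup A] [Module R A]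
    [AddCommGroup B] [Module R B] [AddCommGroup C] [Module R C] {f : A →ₗ[R] B} {g : B →ₗ[R] C}
    {rs : List R} (hf : Function.Injective f) (hfg : Function.Exact f g)
    (hg : Function.Surjective g) (hA : IsWeaklyRegular A rs) (hC : IsWeaklyRegular C rs) :
    IsWeaklyRegular B rs := by
  induction rs generalizing A B C with
  | nil => exact .nil _ _
  | cons r rs ih =>
    rw [isWeaklyRegular_cons_iff] at hA hC ⊢
    have hf_mod : Function.Injective (QuotSMulTop.map r f) := by
      have h := QuotSMulTop.map_first_exact_on_four_term_exact_of_isSMulRegular_last (r := r)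
        ((LinearMap.exact_zero_iff_injective PUnit f).mpr hf) hfg hC.1
      rwa [map_zero, LinearMap.exact_zero_iff_injective] at h
    exact ⟨isSMulRegular_of_range_eq_ker hf hfg.linearMap_ker_eq.symm hA.1 hC.1,
      ih hf_mod (QuotSMulTop.map_exact r hfg hg) (QuotSMulTop.map_surjective r hg) hA.2 hC.2⟩

variable {R M : Type*} [CommRing R] [AddCommGroup M] [Module R M]

/- Multiplication by `a` gives an exact sequence `0 → M / bM → M / abM → M / aM → 0`. -/
lemma isWeaklyRegular_quotSMulTop_mul {a b : R} {rs : List R} (ha : IsSMulRegular M a)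
    (hMa : IsWeaklyRegular (QuotSMulTop a M) rs) (hMb : IsWeaklyRegular (QuotSMulTop b M) rs) :
    IsWeaklyRegular (QuotSMulTop (a * b) M) rs := by
  let f : QuotSMulTop b M →ₗ[R] QuotSMulTop (a * b) M :=
    Submodule.mapQ _ _ (LinearMap.lsmul R M a) (by
      rintro _ ⟨y, -, rfl⟩
      exact ⟨y, trivial, mul_smul a b y⟩)
  let g : QuotSMulTop (a * b) M →ₗ[R] QuotSMulTop a M :=
    Submodule.factor (by
      rintro _ ⟨y, -, rfl⟩
      exact ⟨b • y, trivial, (mul_smul a b y).symm⟩)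
  refine isWeaklyRegular_of_exact (f := f) (g := g) ?_ ?_ (Submodule.factor_surjective _) hMb hMa
  · rw [injective_iff_map_eq_zero]
    intro x hx
    obtain ⟨x, rfl⟩ := Submodule.Quotient.mk_surjective _ x
    obtain ⟨y, -, hy⟩ := (Submodule.Quotient.mk_eq_zero _).mp hx
    exact (Submodule.Quotient.mk_eq_zero _).mpr ⟨y, trivial, ha (by simpa [mul_smul] using hy)⟩
  · intro x
    obtain ⟨x, rfl⟩ := Submodule.Quotient.mk_surjective _ x
    refine ⟨fun hx ↦ ?_, ?_⟩
    · obtain ⟨y, -, hy⟩ := (Submodule.Quotient.mk_eq_zero _).mp hx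
      exact ⟨Submodule.Quotient.mk y, congrArg Submodule.Quotient.mk hy⟩
    · rintro ⟨y, hy⟩
      obtain ⟨y, rfl⟩ := Submodule.Quotient.mk_surjective _ y
      rw [← hy]
      exact (Submodule.Quotient.mk_eq_zero _).mpr ⟨y, trivial, rfl⟩

lemma isWeaklyRegular_quotSMulTop_pow {r : R} {rs : List R} (hr : IsSMulRegular M r)
    (hrs : IsWeaklyRegular (QuotSMulTop r M) rs) (n : ℕ) :
    IsWeaklyRegular (QuotSMulTop (r ^ n) M) rs := by
  induction n with
  | zero =>
    have : Subsingleton (QuotSMulTop (r ^ 0) M) :=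
      Submodule.Quotient.subsingleton_iff.mpr (by rw [pow_zero, one_smul])
    exact isWeaklyRegular_of_subsingleton rs
  | succ n ih =>
    rw [pow_succ]
    exact isWeaklyRegular_quotSMulTop_mul (hr.pow n) ih hrs

lemma isWeaklyRegular_map_pow {rs : List R} (h : IsWeaklyRegular M rs) (n : ℕ) :
    IsWeaklyRegular M (rs.map (· ^ n)) := by
  induction rs generalizing M with
  | nil => exact .nil _ _
  | cons r rs ih =>
    rw [isWeaklyRegular_cons_iff] at h
    exact .cons (h.1.pow n) (isWeaklyRegular_quotSMulTop_pow h.1 (ih h.2) n)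

lemma isLocalRing_quotient_span_singleton [IsLocalRing R] {x : R} (hx : x ∈ maximalIdeal R) :
    IsLocalRing (R ⧸ Ideal.span {x}) :=
  have : Nontrivial (R ⧸ Ideal.span {x}) := Ideal.Quotient.nontrivial_iff.mpr
    (Ideal.span_singleton_ne_top hx)
  .of_surjective' (Ideal.Quotient.mk _) Ideal.Quotient.mk_surjective

lemma ofList_cons_eq_maximalIdeal_iff [IsLocalRing R] {x : R} {rs : List R}
    [IsLocalRing (R ⧸ Ideal.span {x})] :
    Ideal.ofList (x :: rs) = maximalIdeal R ↔
      Ideal.ofList (rs.map (Ideal.Quotient.mk (Ideal.span {x}))) =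
        maximalIdeal (R ⧸ Ideal.span {x}) := by
  have hx : Ideal.span {x} ≤ maximalIdeal R :=
    le_maximalIdeal (Ideal.Quotient.nontrivial_iff.mp inferInstance)
  have hinj := Ideal.comap_injective_of_surjective (Ideal.Quotient.mk (Ideal.span {x}))
    Ideal.Quotient.mk_surjective
  rw [← hinj.eq_iff, ← Ideal.map_ofList,
    ← map_maximalIdeal_of_surjective _ (Ideal.Quotient.mk_surjective (I := Ideal.span {x})),
    Ideal.comap_map_quotientMk, Ideal.comap_map_quotientMk, sup_eq_right.mpr hx, Ideal.ofList_cons]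

theorem free_of_isWeaklyRegular_of_ofList_eq_maximalIdeal [IsLocalRing R] [IsNoetherianRing R]
    [Module.Finite R M] {rs : List R} (hrs : Ideal.ofList rs = maximalIdeal R)
    (hM : IsWeaklyRegular M rs) : Module.Free R M := by
  induction hn : rs.length generalizing R M with
  | zero =>
    rw [List.length_eq_zero_iff.mp hn, Ideal.ofList_nil] at hrs
    let := (isField_iff_maximalIdeal_eq.mpr hrs.symm).toField
    exact Module.Free.of_divisionRing R M
  | succ n ih =>
    obtain _ | ⟨r, rs⟩ := rs
    · contradiction
    rw [isWeaklyRegular_cons_iff'] at hM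
    have hr : r ∈ maximalIdeal R := hrs ▸ Ideal.subset_span List.mem_cons_self
    have := isLocalRing_quotient_span_singleton hr
    have := Module.finitePresentation_of_finite R M
    have := Module.Finite.of_restrictScalars_finite R (R ⧸ Ideal.span {r}) (QuotSMulTop r M)
    rw [← Module.free_quotSMulTop_iff_free R M (maximalIdeal_le_jacobson _ hr) hM.1]
    exact ih (ofList_cons_eq_maximalIdeal_iff.mp hrs) hM.2 (by simpa using hn)

end RegularSequences

section RegularLocalRings

open IsLocalRing RingTheory.Sequence Pointwise

section Noetherian

variable {R : Type*} [CommRing R] [IsLocalRing R] [IsNoetherianRing R]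

lemma exists_span_insert_eq_maximalIdeal {x : R} (hx : x ∈ maximalIdeal R)
    (hx2 : x ∉ maximalIdeal R ^ 2) : ∃ s : Finset R, Ideal.span (insert x (s : Set R)) =
      maximalIdeal R ∧ s.card < (maximalIdeal R).spanFinrank := by
  classical
  obtain ⟨s, hs, hspan⟩ := Submodule.FG.exists_span_finset_card_eq_spanFinrank
    (IsNoetherian.noetherian (maximalIdeal R))
  have hs_mem : (s : Set R) ⊆ maximalIdeal R := Submodule.span_le.mp hspan.le
  obtain ⟨a, -, ha⟩ := Submodule.mem_span_finset.mp (hspan.ge hx)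
  obtain ⟨y, hys, hay⟩ : ∃ y ∈ s, IsUnit (a y) := by
    by_contra! h
    refine hx2 (ha ▸ Ideal.sum_mem _ fun y hy ↦ ?_)
    rw [pow_two]
    exact Ideal.mul_mem_mul ((mem_maximalIdeal _).mpr (h y hy)) (hs_mem hy)
  refine ⟨s.erase y, le_antisymm (Ideal.span_le.mpr ?_) (hspan.ge.trans (Ideal.span_le.mpr ?_)),
    hs ▸ Finset.card_erase_lt_of_mem hys⟩
  · exact Set.insert_subset hx ((Finset.coe_subset.mpr (Finset.erase_subset y s)).trans hs_mem)
  · set I := Ideal.span (insert x (s.erase y : Set R))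
    have hxI : x ∈ I := Ideal.subset_span (Set.mem_insert _ _)
    have herase {z : R} (hz : z ∈ s.erase y) : z ∈ I :=
      Ideal.subset_span (Set.mem_insert_of_mem _ hz)
    have hyI : y ∈ I := by
      rw [← Finset.add_sum_erase _ _ hys] at ha
      refine (Ideal.unit_mul_mem_iff_mem I hay).mp ?_
      rw [← smul_eq_mul, eq_sub_of_add_eq ha]
      exact sub_mem hxI (Ideal.sum_mem _ fun z hz ↦ Ideal.mul_mem_left _ _ (herase hz))
    intro z hz
    obtain rfl | hzy := eq_or_ne z y
    · exact hyI
    · exact herase (Finset.mem_erase.mpr ⟨hzy, hz⟩)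

lemma spanFinrank_maximalIdeal_quotient_span_singleton_lt {x : R}
    [IsLocalRing (R ⧸ Ideal.span {x})] (hx : x ∈ maximalIdeal R) (hx2 : x ∉ maximalIdeal R ^ 2) :
    (maximalIdeal (R ⧸ Ideal.span {x})).spanFinrank < (maximalIdeal R).spanFinrank := by
  obtain ⟨s, hs, hcard⟩ := exists_span_insert_eq_maximalIdeal hx hx2
  set π := Ideal.Quotient.mk (Ideal.span {x})
  have hπx : π x = 0 := Ideal.Quotient.eq_zero_iff_mem.mpr (Ideal.mem_span_singleton_self x)
  have hgen : maximalIdeal (R ⧸ Ideal.span {x}) = Ideal.span (π '' s) := by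
    rw [← map_maximalIdeal_of_surjective π Ideal.Quotient.mk_surjective, ← hs, Ideal.map_span,
      Set.image_insert_eq, hπx, Ideal.span_insert_zero]
  calc (maximalIdeal (R ⧸ Ideal.span {x})).spanFinrank
    _ ≤ (π '' s).ncard := by
      rw [hgen]
      exact Submodule.spanFinrank_span_le_ncard_of_finite (s.finite_toSet.image π)
    _ ≤ s.card := (Set.ncard_image_le s.finite_toSet).trans_eq (Set.ncard_coe_finset s)
    _ < (maximalIdeal R).spanFinrank := hcard

lemma exists_mem_maximalIdeal_notMem_sq_notMem_minimalPrimes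
    (h : maximalIdeal R ∉ minimalPrimes R) :
    ∃ x ∈ maximalIdeal R, x ∉ maximalIdeal R ^ 2 ∧ ∀ P ∈ minimalPrimes R, x ∉ P := by
  by_contra! hcover
  have hfin : (insert (maximalIdeal R ^ 2) (minimalPrimes R)).Finite :=
    (minimalPrimes.finite_of_isNoetherianRing R).insert _
  have hsub : (maximalIdeal R : Set R) ⊆
      ⋃ I ∈ insert (maximalIdeal R ^ 2) (minimalPrimes R), (I : Set R) := by
    intro x hx
    rw [Set.biUnion_insert, Set.mem_union, Set.mem_iUnion₂]
    exact or_iff_not_imp_left.mpr fun hx2 ↦ by simpa using hcover x hx hx2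
  obtain ⟨I, hI, hle⟩ := (Ideal.subset_union_prime_finite (f := id) hfin (maximalIdeal R ^ 2)
    (maximalIdeal R ^ 2) fun I hI hne _ ↦ (hI.resolve_left hne).1.1).mp hsub
  obtain rfl | hI := hI
  · refine ((maximalIdeal_sq_lt_maximalIdeal R).mpr fun hfield ↦ h ?_).not_ge hle
    have := hfield.isDomain
    rw [isField_iff_maximalIdeal_eq.mp hfield, IsDomain.minimalPrimes_eq_singleton_bot]
    rfl
  · have hIprime : I.IsPrime := hI.1.1
    exact h (le_antisymm (le_maximalIdeal hIprime.ne_top) hle ▸ hI)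

/- The minimal prime `P ⊆ (x)` satisfies `P = xP`, hence vanishes by Nakayama. -/
lemma isDomain_of_isPrime_span_singleton {x : R} (hx : ∀ P ∈ minimalPrimes R, x ∉ P)
    [hp : (Ideal.span {x}).IsPrime] : IsDomain R := by
  obtain ⟨P, hP, hPx⟩ := Ideal.exists_minimalPrimes_le (bot_le (a := Ideal.span {x}))
  have hPprime : P.IsPrime := hP.1.1
  have hP0 : P = ⊥ := by
    refine Submodule.eq_bot_of_le_smul_of_le_jacobson_bot (Ideal.span {x}) P
      (IsNoetherian.noetherian P) (fun y hy ↦ ?_)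
      ((le_maximalIdeal hp.ne_top).trans (maximalIdeal_le_jacobson _))
    obtain ⟨z, rfl⟩ := Ideal.mem_span_singleton'.mp (hPx hy)
    rw [mul_comm]
    exact Submodule.smul_mem_smul (Ideal.mem_span_singleton_self x)
      ((hPprime.mem_or_mem hy).resolve_right (hx P hP))
  exact IsDomain.of_bot_isPrime R (hbp := hP0 ▸ hPprime)

end Noetherian

variable {R : Type*} [CommRing R] [IsRegularLocalRing R]

lemma isField_of_maximalIdeal_mem_minimalPrimes (h : maximalIdeal R ∈ minimalPrimes R) :
    IsField R := by
  have hdim := IsRegularLocalRing.spanFinrank_maximalIdeal (R := R)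
  rw [← maximalIdeal_height_eq_ringKrullDim, Ideal.height_eq_zero_iff.mpr h] at hdim
  rw [isField_iff_maximalIdeal_eq,
    ← Submodule.spanFinrank_eq_zero_iff_eq_bot (IsNoetherian.noetherian _)]
  exact_mod_cast hdim

lemma isRegularLocalRing_quotient_span_singleton {x : R} (hx : x ∈ maximalIdeal R)
    (hx2 : x ∉ maximalIdeal R ^ 2) : IsRegularLocalRing (R ⧸ Ideal.span {x}) := by
  have := isLocalRing_quotient_span_singleton hx
  have hrank := spanFinrank_maximalIdeal_quotient_span_singleton_lt hx hx2
  have hdim : ringKrullDim R ≤ ringKrullDim (R ⧸ Ideal.span {x}) + 1 := by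
    rw [← Ideal.mul_top (Ideal.span {x}), ← smul_eq_mul, Submodule.ideal_span_singleton_smul]
    exact ringKrullDim_le_ringKrullDim_quotSMulTop_succ hx
  refine .of_spanFinrank_maximalIdeal_le _ (ENat.WithBot.add_le_add_one_right_iff.mp ?_)
  refine le_trans ?_ (IsRegularLocalRing.spanFinrank_maximalIdeal (R := R) ▸ hdim)
  exact_mod_cast hrank

theorem isDomain_of_isRegularLocalRing (R : Type*) [CommRing R] [IsRegularLocalRing R] :
    IsDomain R := by
  induction hn : (maximalIdeal R).spanFinrank using Nat.strong_induction_on generalizing R with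
  | h n ih =>
    by_cases h : maximalIdeal R ∈ minimalPrimes R
    · exact (isField_of_maximalIdeal_mem_minimalPrimes h).isDomain
    · obtain ⟨x, hx, hx2, hmin⟩ := exists_mem_maximalIdeal_notMem_sq_notMem_minimalPrimes h
      have := isRegularLocalRing_quotient_span_singleton hx hx2
      have hlt := spanFinrank_maximalIdeal_quotient_span_singleton_lt hx hx2
      have : (Ideal.span {x}).IsPrime :=
        (Ideal.Quotient.isDomain_iff_prime _).mp (ih _ (hn ▸ hlt) _ rfl)
      exact isDomain_of_isPrime_span_singleton hmin

theorem exists_isWeaklyRegular_ofList_eq_maximalIdeal (R : Type*) [CommRing R]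
    [IsRegularLocalRing R] :
    ∃ rs : List R, IsWeaklyRegular R rs ∧ Ideal.ofList rs = maximalIdeal R := by
  induction hn : (maximalIdeal R).spanFinrank using Nat.strong_induction_on generalizing R with
  | h n ih =>
    by_cases hfield : IsField R
    · exact ⟨[], .nil _ _, by rw [Ideal.ofList_nil, isField_iff_maximalIdeal_eq.mp hfield]⟩
    have := isDomain_of_isRegularLocalRing R
    obtain ⟨x, hx, hx2⟩ :=
      SetLike.exists_of_lt ((maximalIdeal_sq_lt_maximalIdeal R).mpr hfield)
    have := isRegularLocalRing_quotient_span_singleton hx hx2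
    have hlt := spanFinrank_maximalIdeal_quotient_span_singleton_lt hx hx2
    obtain ⟨rs, hrs, hrs_max⟩ := ih _ (hn ▸ hlt) _ rfl
    obtain ⟨rs, rfl⟩ := List.map_surjective_iff.mpr Ideal.Quotient.mk_surjective rs
    have hx_reg : IsSMulRegular R x := .of_ne_zero fun h ↦ hx2 (h ▸ zero_mem _)
    refine ⟨x :: rs, .cons hx_reg ?_, ofList_cons_eq_maximalIdeal_iff.mpr hrs_max⟩
    have htop : x • (⊤ : Submodule R R) = Ideal.span {x} := by
      rw [← Submodule.ideal_span_singleton_smul, smul_eq_mul, Ideal.mul_top]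
    rwa [(Submodule.quotEquivOfEq _ _ htop).isWeaklyRegular_congr,
      ← isWeaklyRegular_map_algebraMap_iff (R ⧸ Ideal.span {x})]

end RegularLocalRings

lemma finite_iterateFrobenius {R : Type*} [CommRing R] {p : ℕ} [ExpChar R p]
    (hF : (frobenius R p).Finite) (n : ℕ) : (iterateFrobenius R p n).Finite := by
  induction n with
  | zero =>
    rw [iterateFrobenius_zero]
    exact RingHom.Finite.id R
  | succ n ih =>
    rw [iterateFrobenius_add, iterateFrobenius_one]
    exact ih.comp hF

namespace FrobeniusPushforward

variable (R : Type*) [CommRing R] (p e : ℕ)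

lemma finite [ExpChar R p] (hF : (frobenius R p).Finite) :
    Module.Finite R (FrobeniusPushforward R p e) :=
  (RingHom.Finite.of_surjective _ (of R p e).surjective).comp (finite_iterateFrobenius hF e)

lemma isWeaklyRegular_iff_map_pow [ExpChar R p] (rs : List R) :
    RingTheory.Sequence.IsWeaklyRegular (FrobeniusPushforward R p e) rs ↔
      RingTheory.Sequence.IsWeaklyRegular R (rs.map (· ^ p ^ e)) := by
  refine (of R p e).symm.toAddEquiv.isWeaklyRegular_congr ?_
  rw [List.forall₂_map_right_iff, List.forall₂_same]
  exact fun _ _ _ ↦ rfl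

theorem free_of_isRegularLocalRing [IsRegularLocalRing R] [ExpChar R p]
    [Module.Finite R (FrobeniusPushforward R p e)] :
    Module.Free R (FrobeniusPushforward R p e) := by
  obtain ⟨rs, hrs, hrs_max⟩ := exists_isWeaklyRegular_ofList_eq_maximalIdeal R
  exact free_of_isWeaklyRegular_of_ofList_eq_maximalIdeal hrs_max
    ((isWeaklyRegular_iff_map_pow R p e rs).mpr (isWeaklyRegular_map_pow hrs _))

section Localization

variable {R} {S : Type*} [CommRing S] [Algebra R S] [ExpChar S p]
  [Module R (FrobeniusPushforward S p e)] [IsScalarTower R S (FrobeniusPushforward S p e)]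

lemma algebraMap_smul_of (r : R) (x : S) :
    r • of S p e x = of S p e (algebraMap R S r ^ p ^ e * x) := by
  rw [← smul_of, algebraMap_smul]

variable [ExpChar R p]

/-- The map `F^e_* R → F^e_* S` induced by the structure map of an `R`-algebra `S`. It compares
`F^e_* S` with the localization of `F^e_* R` when `S` is a localization of `R`. -/
noncomputable def mapAlgebraMap :
    FrobeniusPushforward R p e →ₗ[R] FrobeniusPushforward S p e where
  toFun x := of S p e (algebraMap R S ((of R p e).symm x))
  map_add' x y := by simp
  map_smul' r x := by
    obtain ⟨x, rfl⟩ := (of R p e).surjective x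
    rw [smul_of, RingHom.id_apply, algebraMap_smul_of]
    simp

lemma mapAlgebraMap_of (x : R) :
    (mapAlgebraMap p e (of R p e x) : FrobeniusPushforward S p e) = of S p e (algebraMap R S x) :=
  rfl

/- A fraction `a / s` in `F^e_* S` is `s⁻¹ • (s ^ (p ^ e - 1) * a)`. -/
lemma isLocalizedModule_mapAlgebraMap (T : Submonoid R) [IsLocalization T S] :
    IsLocalizedModule T
      (mapAlgebraMap p e : FrobeniusPushforward R p e →ₗ[R] FrobeniusPushforward S p e) where
  map_units s := by
    refine (Module.End.isUnit_iff _).mpr ?_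
    convert MulAction.bijective (α := Sˣ) (β := FrobeniusPushforward S p e)
      (IsLocalization.map_units S s).unit using 1
    ext x
    simp [Units.smul_def]
  surj y := by
    obtain ⟨y, rfl⟩ := (of S p e).surjective y
    obtain ⟨a, s, rfl⟩ := IsLocalization.exists_mk'_eq T y
    refine ⟨(of R p e ((s : R) ^ (p ^ e - 1) * a), s), ?_⟩
    rw [mapAlgebraMap_of, Submonoid.smul_def, algebraMap_smul_of,
      ← pow_sub_one_mul (expChar_pow_pos R p e).ne' (algebraMap R S s), mul_assoc,
      IsLocalization.mk'_spec', map_mul (algebraMap R S), map_pow (algebraMap R S)]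
  exists_of_eq {x y} h := by
    obtain ⟨x, rfl⟩ := (of R p e).surjective x
    obtain ⟨y, rfl⟩ := (of R p e).surjective y
    obtain ⟨c, hc⟩ := IsLocalization.exists_of_eq (M := T) ((of S p e).injective h)
    refine ⟨c, ?_⟩
    rw [RingEquiv.symm_apply_apply, RingEquiv.symm_apply_apply] at hc
    rw [Submonoid.smul_def, Submonoid.smul_def, smul_of, smul_of,
      ← pow_sub_one_mul (expChar_pow_pos R p e).ne' (c : R), mul_assoc, mul_assoc, hc]

end Localization

theorem mem_freeLocus [IsRegularRing R] [Fact p.Prime] [CharP R p]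
    [Module.Finite R (FrobeniusPushforward R p e)] (P : PrimeSpectrum R) :
    P ∈ Module.freeLocus R (FrobeniusPushforward R p e) := by
  let S := Localization.AtPrime P.asIdeal
  have : CharP S p := charP_of_injective_ringHom
    ((algebraMap R S).comp (ZMod.castHom dvd_rfl R)).injective p
  let : Module R (FrobeniusPushforward S p e) := Module.compHom _ (algebraMap R S)
  have : IsScalarTower R S (FrobeniusPushforward S p e) := .of_algebraMap_smul fun _ _ ↦ rfl
  have := isLocalizedModule_mapAlgebraMap (S := S) p e P.asIdeal.primeCompl
  have : Module.Finite S (FrobeniusPushforward S p e) :=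
    Module.Finite.of_isLocalizedModule P.asIdeal.primeCompl (mapAlgebraMap p e)
  rw [Module.mem_freeLocus_of_isLocalization P S (FrobeniusPushforward S p e) (mapAlgebraMap p e)]
  exact free_of_isRegularLocalRing S p e

theorem projective [IsRegularRing R] [Fact p.Prime] [CharP R p]
    [Module.Finite R (FrobeniusPushforward R p e)] :
    Module.Projective R (FrobeniusPushforward R p e) :=
  have := Module.finitePresentation_of_finite R (FrobeniusPushforward R p e)
  Module.freeLocus_eq_univ_iff.mp (Set.eq_univ_of_forall (mem_freeLocus R p e))

lemma faithfullyFlat [ExpChar R p] [Module.Flat R (FrobeniusPushforward R p e)] :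
    Module.FaithfullyFlat R (FrobeniusPushforward R p e) := by
  refine .of_comap_surjective fun P ↦ ⟨PrimeSpectrum.comap (of R p e).symm P, ?_⟩
  ext r
  exact P.isPrime.pow_mem_iff_mem _ (expChar_pow_pos R p e)

end FrobeniusPushforward

theorem isLocallyFreeOfFiniteRank_of_projective (R M : Type*) [CommRing R] [AddCommGroup M]
    [Module R M] [Module.Finite R M] [Module.Projective R M] : IsLocallyFreeOfFiniteRank R M := by
  intro P
  have := Module.finitePresentation_of_projective R M
  have : Module.Free (Localization.AtPrime P.asIdeal) (LocalizedModule P.asIdeal.primeCompl M) :=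
    (Module.freeLocus_eq_univ (R := R) (M := M)).ge (Set.mem_univ P)
  obtain ⟨f, hf, hfree, -⟩ := Module.FinitePresentation.exists_free_localizedModule_powers
    P.asIdeal.primeCompl (LocalizedModule.mkLinearMap P.asIdeal.primeCompl M)
    (Localization.AtPrime P.asIdeal)
  exact ⟨f, hf, hfree, .of_isLocalizedModule (.powers f) (LocalizedModule.mkLinearMap _ M)⟩

section Morita

/-- For an `R`-module `P` and a left `End_R(P)`-module `N`, the relations that turn
`Hom_R(P, R) ⊗_ℤ N` into the tensor product over the noncommutative ring `End_R(P)`, which acts on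
`Hom_R(P, R)` from the right by pre-composition. -/
def dualBalancing (R P N : Type*) [CommRing R] [AddCommGroup P] [Module R P] [AddCommGroup N]
    [Module (Module.End R P) N] : Submodule R (Module.Dual R P ⊗[ℤ] N) :=
  Submodule.span R {t | ∃ (φ : Module.Dual R P) (δ : Module.End R P) (n : N),
    t = (φ ∘ₗ δ) ⊗ₜ[ℤ] n - φ ⊗ₜ[ℤ] (δ • n)}

/-- The tensor product `Hom_R(P, R) ⊗_{End_R(P)} N`, an `R`-module through `Hom_R(P, R)`. For
`P = F^e_* R` this is `FrobeniusDescentObj`. -/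
abbrev DualTensor (R P N : Type*) [CommRing R] [AddCommGroup P] [Module R P] [AddCommGroup N]
    [Module (Module.End R P) N] :=
  (Module.Dual R P ⊗[ℤ] N) ⧸ dualBalancing R P N

namespace DualTensor

variable {R P M M' N N' Q : Type*} [CommRing R] [AddCommGroup P] [Module R P]
  [AddCommGroup M] [Module R M] [AddCommGroup M'] [Module R M']
  [AddCommGroup N] [Module (Module.End R P) N] [AddCommGroup N'] [Module (Module.End R P) N']
  [AddCommGroup Q] [Module R Q]

/-- The functoriality `id ⊗ g` of `Hom_R(P, R) ⊗_{End_R(P)} N` in `N`. -/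
noncomputable def map (g : N →ₗ[Module.End R P] N') : DualTensor R P N →ₗ[R] DualTensor R P N' :=
  Submodule.mapQ _ _
    (TensorProduct.AlgebraTensorModule.map LinearMap.id g.toAddMonoidHom.toIntLinearMap)
    (by
      rw [dualBalancing, Submodule.span_le]
      rintro _ ⟨φ, δ, n, rfl⟩
      refine Submodule.subset_span ⟨φ, δ, g n, ?_⟩
      simp)

variable [Module R N] [IsScalarTower R (Module.End R P) N]
  [Module R N'] [IsScalarTower R (Module.End R P) N']

/-- The class `φ ⊗ n` in `Hom_R(P, R) ⊗_{End_R(P)} N`. -/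
def tmul (φ : Module.Dual R P) : N →ₗ[R] DualTensor R P N where
  toFun n := Submodule.Quotient.mk (φ ⊗ₜ[ℤ] n)
  map_add' n n' := by rw [TensorProduct.tmul_add, Submodule.Quotient.mk_add]
  map_smul' r n := by
    have h : r • n = (r • 1 : Module.End R P) • n := by rw [smul_assoc, one_smul]
    rw [RingHom.id_apply, h, ← Submodule.Quotient.mk_smul, TensorProduct.smul_tmul', eq_comm,
      Submodule.Quotient.eq]
    refine Submodule.subset_span ⟨φ, r • 1, n, ?_⟩
    congr 2
    ext
    simp

lemma smul_tmul (r : R) (φ : Module.Dual R P) (n : N) : tmul (r • φ) n = r • tmul φ n :=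
  rfl

lemma tmul_smul (φ : Module.Dual R P) (δ : Module.End R P) (n : N) :
    tmul φ (δ • n) = tmul (φ ∘ₗ δ) n :=
  Eq.symm <| (Submodule.Quotient.eq _).mpr <| Submodule.subset_span ⟨φ, δ, n, rfl⟩

lemma map_tmul (g : N →ₗ[Module.End R P] N') (φ : Module.Dual R P) (n : N) :
    map g (tmul φ n) = tmul φ (g n) :=
  rfl

lemma hom_ext {f g : DualTensor R P N →ₗ[R] Q} (h : ∀ φ, f ∘ₗ tmul φ = g ∘ₗ tmul φ) : f = g := by
  refine Submodule.linearMap_qext _ (TensorProduct.AlgebraTensorModule.ext fun φ n ↦ ?_)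
  exact LinearMap.congr_fun (h φ) n

/-- The map `φ ⊗ n ↦ f φ n` induced by an `End_R(P)`-balanced bilinear map `f`. -/
noncomputable def lift (f : Module.Dual R P →ₗ[R] N →ₗ[R] Q)
    (hf : ∀ φ (δ : Module.End R P) n, f (φ ∘ₗ δ) n = f φ (δ • n)) : DualTensor R P N →ₗ[R] Q :=
  Submodule.liftQ _
    (TensorProduct.AlgebraTensorModule.lift (LinearMap.restrictScalarsₗ ℤ R N Q R ∘ₗ f))
    (by
      rw [dualBalancing, Submodule.span_le]
      rintro _ ⟨φ, δ, n, rfl⟩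
      simp [hf])

lemma comp_smulRight (φ ψ : Module.Dual R P) (x : P) : φ ∘ₗ ψ.smulRight x = φ x • ψ := by
  ext z
  simp [mul_comm]

section Unit

variable (R P M) in
/-- The evaluation `Hom_R(P, R) ⊗_{End_R(P)} (P ⊗_R M) → M`, `φ ⊗ x ⊗ m ↦ φ(x) m`, which is the
inverse of the unit of the Morita equivalence. -/
noncomputable def eval : DualTensor R P (P ⊗[R] M) →ₗ[R] M :=
  lift ((TensorProduct.lid R M).toLinearMap.compRight R ∘ₗ LinearMap.rTensorHom M)
    fun φ δ t ↦ congrArg (TensorProduct.lid R M) (LinearMap.rTensor_comp_apply M φ δ t)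

lemma eval_tmul_tmul (φ : Module.Dual R P) (x : P) (m : M) :
    eval R P M (tmul φ (x ⊗ₜ[R] m)) = φ x • m :=
  rfl

lemma eval_map_map (f : M →ₗ[R] M') (t : DualTensor R P (P ⊗[R] M)) :
    eval R P M' (map (TensorProduct.AlgebraTensorModule.map LinearMap.id f) t) =
      f (eval R P M t) := by
  suffices eval R P M' ∘ₗ map (TensorProduct.AlgebraTensorModule.map LinearMap.id f) =
      f ∘ₗ eval R P M from LinearMap.congr_fun this t
  refine hom_ext fun φ ↦ TensorProduct.ext' fun x m ↦ ?_
  simp [map_tmul, eval_tmul_tmul]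

/- Moving the rank one operator `ψ(-) x` across the tensor product,
`φ ⊗ ψ(y) x ⊗ m = (φ ∘ ψ(-) x) ⊗ y ⊗ m = φ(x) (ψ ⊗ y ⊗ m)`. -/
lemma tmul_tmul_eval (φ : Module.Dual R P) (x : P) (t : DualTensor R P (P ⊗[R] M)) :
    tmul φ (x ⊗ₜ[R] eval R P M t) = φ x • t := by
  suffices tmul φ ∘ₗ TensorProduct.mk R P M x ∘ₗ eval R P M = φ x • LinearMap.id from
    LinearMap.congr_fun this t
  refine hom_ext fun ψ ↦ TensorProduct.ext' fun y m ↦ ?_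
  have hδ : x ⊗ₜ[R] (ψ y • m) = (ψ.smulRight x : Module.End R P) • (y ⊗ₜ[R] m) :=
    (TensorProduct.smul_tmul (ψ y) x m).symm
  calc tmul φ (x ⊗ₜ[R] (ψ y • m))
    _ = tmul (φ ∘ₗ ψ.smulRight x) (y ⊗ₜ[R] m) := by rw [hδ, tmul_smul]
    _ = φ x • tmul ψ (y ⊗ₜ[R] m) := by rw [comp_smulRight, smul_tmul]

lemma eval_bijective (h : Function.Surjective (contractLeft R P)) :
    Function.Bijective (eval R P M) := by
  obtain ⟨c, hc⟩ := h 1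
  refine ⟨(injective_iff_map_eq_zero _).mpr fun t ht ↦ ?_, fun m ↦ ?_⟩
  · suffices ∀ c, contractLeft R P c • t = 0 by rw [← one_smul R t, ← hc, this]
    intro c
    induction c with
    | zero => rw [map_zero, zero_smul]
    | tmul φ x => rw [contractLeft_apply, ← tmul_tmul_eval, ht, TensorProduct.tmul_zero, map_zero]
    | add c d hc hd => rw [map_add, add_smul, hc, hd, add_zero]
  · suffices ∀ c, contractLeft R P c • m ∈ LinearMap.range (eval R P M) by
      rw [← LinearMap.mem_range, ← one_smul R m, ← hc]
      exact this c
    intro c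
    induction c with
    | zero => simp only [map_zero, zero_smul, zero_mem]
    | tmul φ x => exact ⟨_, eval_tmul_tmul φ x m⟩
    | add c d hc hd => rw [map_add, add_smul]; exact add_mem hc hd

end Unit

section Counit

variable (R P N) in
/-- The action `P ⊗_R (Hom_R(P, R) ⊗_{End_R(P)} N) → N`, `x ⊗ φ ⊗ n ↦ (φ(-) x) n`, of the rank one
operators, which is the counit of the Morita equivalence. -/
noncomputable def act : P ⊗[R] DualTensor R P N →ₗ[Module.End R P] N :=
  TensorProduct.AlgebraTensorModule.lift
    { toFun x := lift ((Algebra.lsmul R R N).toLinearMap ∘ₗ LinearMap.smulRightₗ.flip x)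
        fun φ δ n ↦ mul_smul (φ.smulRight x : Module.End R P) δ n
      map_add' x y := hom_ext fun φ ↦ LinearMap.ext fun n ↦
        (congrArg (· • n) (map_add (LinearMap.smulRightₗ φ) x y)).trans (add_smul _ _ n)
      map_smul' δ x := hom_ext fun φ ↦ LinearMap.ext fun n ↦
        (congrArg (· • n) (LinearMap.ext fun z ↦ (δ.map_smul (φ z) x).symm)).trans
          (mul_smul δ (φ.smulRight x : Module.End R P) n) }

lemma act_tmul_tmul (x : P) (φ : Module.Dual R P) (n : N) :
    act R P N (x ⊗ₜ[R] tmul φ n) = (φ.smulRight x : Module.End R P) • n :=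
  rfl

lemma act_map_map (g : N →ₗ[Module.End R P] N') (t : P ⊗[R] DualTensor R P N) :
    act R P N' (TensorProduct.AlgebraTensorModule.map
      (LinearMap.id : P →ₗ[Module.End R P] P) (map g) t) = g (act R P N t) := by
  suffices (act R P N').restrictScalars R ∘ₗ (map g).lTensor P =
      g.restrictScalars R ∘ₗ (act R P N).restrictScalars R from LinearMap.congr_fun this t
  refine TensorProduct.ext (LinearMap.ext fun x ↦ hom_ext fun φ ↦ LinearMap.ext fun n ↦ ?_)
  simp [map_tmul, act_tmul_tmul]

lemma tmul_act (x : P) (φ : Module.Dual R P) (t : P ⊗[R] DualTensor R P N) :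
    x ⊗ₜ[R] tmul φ (act R P N t) = (φ.smulRight x : Module.End R P) • t := by
  suffices TensorProduct.mk R P _ x ∘ₗ tmul φ ∘ₗ (act R P N).restrictScalars R =
      (φ.smulRight x).rTensor (DualTensor R P N) from LinearMap.congr_fun this t
  refine TensorProduct.ext (LinearMap.ext fun y ↦ hom_ext fun ψ ↦ LinearMap.ext fun n ↦ ?_)
  calc x ⊗ₜ[R] tmul φ ((ψ.smulRight y : Module.End R P) • n)
    _ = x ⊗ₜ[R] (φ y • tmul ψ n) := by rw [tmul_smul, comp_smulRight, smul_tmul]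
    _ = (φ y • x) ⊗ₜ[R] tmul ψ n := (TensorProduct.smul_tmul _ _ _).symm

lemma act_bijective (h : Function.Surjective (dualTensorHom R P P)) :
    Function.Bijective (act R P N) := by
  obtain ⟨c, hc⟩ := h 1
  refine ⟨(injective_iff_map_eq_zero _).mpr fun t ht ↦ ?_, fun n ↦ ?_⟩
  · suffices ∀ c, (dualTensorHom R P P c : Module.End R P) • t = 0 by
      rw [← one_smul (Module.End R P) t, ← hc, this]
    intro c
    induction c with
    | zero => rw [map_zero, zero_smul]
    | tmul φ x => exact (tmul_act x φ t).symm.trans (by rw [ht, map_zero, TensorProduct.tmul_zero])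
    | add c d hc hd => rw [map_add, add_smul, hc, hd, add_zero]
  · suffices ∀ c, (dualTensorHom R P P c : Module.End R P) • n ∈ LinearMap.range (act R P N) by
      rw [← LinearMap.mem_range, ← one_smul (Module.End R P) n, ← hc]
      exact this c
    intro c
    induction c with
    | zero => simp only [map_zero, zero_smul, zero_mem]
    | tmul φ x => exact ⟨_, act_tmul_tmul x φ n⟩
    | add c d hc hd => rw [map_add, add_smul]; exact add_mem hc hd

end Counit

end DualTensor

lemma contractLeft_surjective (R P : Type*) [CommRing R] [AddCommGroup P] [Module R P]
    [Module.Projective R P] [Module.FaithfullyFlat R P] :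
    Function.Surjective (contractLeft R P) := by
  obtain ⟨s, hs⟩ := Module.projective_def.mp ‹Module.Projective R P›
  have htop : LinearMap.range (contractLeft R P) • (⊤ : Submodule R P) = ⊤ := by
    refine eq_top_iff.mpr fun x _ ↦ ?_
    rw [← hs x, Finsupp.linearCombination_apply]
    refine Submodule.sum_mem _ fun y _ ↦ Submodule.smul_mem_smul ?_ trivial
    exact ⟨(Finsupp.lapply y ∘ₗ s) ⊗ₜ x, rfl⟩
  rw [← LinearMap.range_eq_top]
  by_contra hne
  exact ((Module.FaithfullyFlat.iff_flat_and_proper_ideal R P).mp inferInstance).2 _ hne htop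

section Functors

universe w

variable (R : Type u) [CommRing R] (P : Type w) [AddCommGroup P] [Module R P]

/-- The functor `P ⊗_R (-)` from `R`-modules to `End_R(P)`-modules. For `P = F^e_* R` this is
`frobeniusPullback`. -/
noncomputable def tensorFunctor :
    ModuleCat.{max u v w} R ⥤ ModuleCat.{max u v w} (Module.End R P) where
  obj M := ModuleCat.of (Module.End R P) (P ⊗[R] M)
  map f := ModuleCat.ofHom (TensorProduct.AlgebraTensorModule.map
    (LinearMap.id : P →ₗ[Module.End R P] P) f.hom)
  map_id M := by
    ext
    rfl
  map_comp f g := by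
    ext
    rfl

/-- The functor `Hom_R(P, R) ⊗_{End_R(P)} (-)` from `End_R(P)`-modules to `R`-modules. For
`P = F^e_* R` this is `frobeniusDescent`. -/
noncomputable def dualTensorFunctor :
    ModuleCat.{max u v w} (Module.End R P) ⥤ ModuleCat.{max u v w} R where
  obj N := ModuleCat.of R (DualTensor R P N)
  map g := ModuleCat.ofHom (DualTensor.map g.hom)
  map_id N := by
    ext
    rfl
  map_comp f g := by
    ext
    rfl

lemma tensorFunctor_linear : (tensorFunctor.{v} R P).Linear R where
  map_smul {M N} f r := by
    suffices (r • f.hom).lTensor P = r • f.hom.lTensor P from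
      ModuleCat.hom_ext (LinearMap.ext fun t ↦ LinearMap.congr_fun this t)
    exact LinearMap.lTensor_smul P r f.hom

/-- The Morita equivalence between `R`-modules and `End_R(P)`-modules given by a progenerator `P`;
a finite projective module over a commutative ring is a generator when it is faithfully flat. -/
noncomputable def moritaEquivalence [Module.Finite R P] [Module.Projective R P]
    [Module.FaithfullyFlat R P] :
    ModuleCat.{max u v w} R ≌ ModuleCat.{max u v w} (Module.End R P) :=
  CategoryTheory.Equivalence.mk (tensorFunctor.{v} R P) (dualTensorFunctor.{v} R P)
    (NatIso.ofComponents (F := tensorFunctor.{v} R P ⋙ dualTensorFunctor.{v} R P) (G := 𝟭 _)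
      (fun M ↦ (LinearEquiv.ofBijective (DualTensor.eval R P M)
        (DualTensor.eval_bijective (contractLeft_surjective R P))).toModuleIso)
      (fun f ↦ ModuleCat.hom_ext (LinearMap.ext fun t ↦
        DualTensor.eval_map_map f.hom t))).symm
    (NatIso.ofComponents (F := dualTensorFunctor.{v} R P ⋙ tensorFunctor.{v} R P) (G := 𝟭 _)
      (fun N ↦ (LinearEquiv.ofBijective (DualTensor.act R P N)
        (DualTensor.act_bijective dualTensorHom_bijective.surjective)).toModuleIso)
      (fun g ↦ ModuleCat.hom_ext (LinearMap.ext fun t ↦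
        DualTensor.act_map_map g.hom t)))

end Functors

end Morita

theorem mainTheorem4 (R : Type u) [CommRing R] [IsRegularRing R] (p : ℕ) [Fact p.Prime]
    [CharP R p] (hF : (frobenius R p).Finite) (e : ℕ) :
    IsLocallyFreeOfFiniteRank R (FrobeniusPushforward R p e) ∧
    ∃ E : ModuleCat.{max u v} R ≌ ModuleCat.{max u v} (FrobeniusDiffOp R p e),
      E.functor = frobeniusPullback.{v} R p e ∧
      E.inverse = frobeniusDescent.{v} R p e ∧
      E.functor.Linear R := by
  have := FrobeniusPushforward.finite R p e hF
  have := FrobeniusPushforward.projective R p e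
  have := FrobeniusPushforward.faithfullyFlat R p e
  exact ⟨isLocallyFreeOfFiniteRank_of_projective R (FrobeniusPushforward R p e),
    moritaEquivalence.{v} R (FrobeniusPushforward R p e), rfl, rfl,
    tensorFunctor_linear.{v} R (FrobeniusPushforward R p e)⟩
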